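/- Let $\Bbbk$ be a field, let $n \ge 2$, and let $S = \Bbbk[x_1,\dots,x_n]$ with the standard grading. For $1 \le i \le n$ put $f_i = x_i x_{i+1}\cdots x_{i+n-3}$ (the product of $n-2$ consecutive variables, with indices taken modulo $n$ in $\{1,\dots,n\}$; for $n=2$ the empty product, $f_i = 1$), and let $$I_n = (f_1,f_2,\dots,f_n), \qquad J_n = (f_1,f_3,\dots,f_n),$$ so that $I_n$ is generated by all the $f_i$ and $J_n$ by all the $f_i$ with $i \ne 2$ (in particular $I_2=J_2=S$). Then for all integers $s,t \ge 0$ the ideals $$B_{n,s,t} = J_n^s I_n^t \quad\text{and}\quad C_{n,s,t} = J_n^s (x_1,x_n)^t$$ have linear free resolutions. Here an ideal $I$ of $S$ has a linear free resolution if, for some integer $d \ge 0$, there is an exact sequence of graded $S$-modules with degree-preserving maps $$\cdots \to S(-d-2)^{b_2} \to S(-d-1)^{b_1} \to S(-d)^{b_0} \to I \to 0$$ with all $b_i$ finite. -/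

import Mathlib

open MvPolynomial

noncomputable section

/-- A `d`-linear graded free resolution
`⋯ → S(-d-2)^{ι 2} → S(-d-1)^{ι 1} → S(-d)^{ι 0} → I → 0`
of an ideal `I` of the standard graded polynomial ring `S = K[x_j | j ∈ σ]`, written in
bases: each `ι i` is a finite basis of the `i`-th free module, the augmentation sends the basis
of the zeroth module to forms of degree `d` that generate `I`, and the differentials are matrices
all of whose entries are linear forms (or zero).  Such a resolution is automatically minimal. -/
structure LinearFreeResolution {K : Type*} [Field K] {σ : Type*}
    (I : Ideal (MvPolynomial σ K)) (d : ℕ) where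
  /-- basis of the `i`-th free module -/
  ι : ℕ → Type
  /-- the free modules have finite rank -/
  finite_rank : ∀ i, Fintype (ι i)
  /-- images in `I` of the basis elements of the zeroth free module -/
  gen : ι 0 → MvPolynomial σ K
  /-- matrix of the differential from the `(i+1)`-st to the `i`-th free module -/
  diff : ∀ i, Matrix (ι i) (ι (i + 1)) (MvPolynomial σ K)
  gen_isHomogeneous : ∀ a, (gen a).IsHomogeneous d
  diff_isHomogeneous : ∀ i a b, (diff i a b).IsHomogeneous 1
  span_gen : Ideal.span (Set.range gen) = I
  exact_zero : Function.Exact (diff 0).mulVecLin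
    (Fintype.linearCombination (MvPolynomial σ K) gen)
  exact_succ : ∀ i, Function.Exact (diff (i + 1)).mulVecLin (diff i).mulVecLin

/-- The ideal `I` has a linear free resolution: it has a `d`-linear one for some `d`. -/
def HasLinearFreeResolution {K : Type*} [Field K] {σ : Type*}
    (I : Ideal (MvPolynomial σ K)) : Prop :=
  ∃ d : ℕ, Nonempty (LinearFreeResolution I d)

/-- The product of the `n - 2` cyclically consecutive variables starting at the index `i`.
The variables `x_1, …, x_n` are indexed by `0, …, n - 1`, so that `pathMonomial K n i` is
`f_{i+1} = x_{i+1} x_{i+2} ⋯ x_{i+n-2}`, indices modulo `n`.  For `n = 2` it is `1`. -/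
def pathMonomial (K : Type*) [Field K] (n : ℕ) (i : Fin n) : MvPolynomial (Fin n) K :=
  ∏ k ∈ Finset.range (n - 2), X ⟨(i.val + k) % n, Nat.mod_lt _ i.pos⟩

/-- `I_n = (f_1, …, f_n)`, the `(n-2)`-path ideal of the `n`-cycle. -/
def pathIdealI (K : Type*) [Field K] (n : ℕ) : Ideal (MvPolynomial (Fin n) K) :=
  Ideal.span (Set.range (pathMonomial K n))

/-- `J_n = (f_1, f_3, …, f_n)`: the generator `f_2` (of index `1`) is left out. -/
def pathIdealJ (K : Type*) [Field K] (n : ℕ) : Ideal (MvPolynomial (Fin n) K) :=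
  Ideal.span (pathMonomial K n '' {i | i.val ≠ 1})

/-- `B_{n,s,t} = J_n^s I_n^t`. -/
def idealB (K : Type*) [Field K] (n s t : ℕ) : Ideal (MvPolynomial (Fin n) K) :=
  pathIdealJ K n ^ s * pathIdealI K n ^ t

/-- `C_{n,s,t} = J_n^s (x_1, x_n)^t`. -/
def idealC (K : Type*) [Field K] (n : ℕ) (hn : 2 ≤ n) (s t : ℕ) :
    Ideal (MvPolynomial (Fin n) K) :=
  pathIdealJ K n ^ s *
    Ideal.span {X (⟨0, by omega⟩ : Fin n), X (⟨n - 1, by omega⟩ : Fin n)} ^ t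

end

/-! Both families have linear quotients. If a set of monomials of one degree is listed in decreasing
lexicographic order and the colon ideal of the earlier ones by the next is always generated by
variables, then each new monomial extends the relation module by an ideal of variables. Such ideals
have linear resolutions (Koszul), and linearity passes to graded extensions. This is
`HasLinearRelations.insert`, iterated in `hasLinearFreeResolution_monomialSpan`, which asks only for
a weak exchange property.

To verify exchange, note that each `f_i` is the product of all variables divided by the two ends of
an edge of the `n`-cycle, the omitted `f_2` belonging to the edge `{x_n, x_1}`. A product of `N` of
them has exponents `N` minus the degrees of a multigraph on the cycle. For `B` the multiplicity `a
0` of the special edge lies in `[0, t]`; for `C` the same coordinate, now in `[-t, 0]`, records how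
the `t` further factors split between `x_1` and `x_n`. A sign `ε` lets `exists_exchange` treat both
at once: below the first differing exponent the difference of two multiplicity vectors alternates in
sign, so one can either slide an edge to the right or move by one alternating unit vector towards
the larger monomial. -/

noncomputable section

/-! ### Linear submodules, their extensions, and ideals of variables. -/

section LinearRelations

variable {σ : Type*} {K : Type*} [Field K]

/-- A submodule of `S^ι` is linear if it is the image of a matrix of linear forms whose kernel
is again linear (coinductively). -/
def IsLinearSubmodule {ι : Type} [Fintype ι]
    (R : Submodule (MvPolynomial σ K) (ι → MvPolynomial σ K)) : Prop :=
  ∃ P : ∀ (ι : Type) [Fintype ι], Submodule (MvPolynomial σ K) (ι → MvPolynomial σ K) → Prop,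
    (∀ (ι : Type) [Fintype ι] (R : Submodule (MvPolynomial σ K) (ι → MvPolynomial σ K)),
      P ι R → ∃ (κ : Type) (_ : Fintype κ) (D : Matrix ι κ (MvPolynomial σ K)),
        (∀ i k, (D i k).IsHomogeneous 1) ∧ LinearMap.range D.mulVecLin = R ∧
          P κ (LinearMap.ker D.mulVecLin)) ∧ P ι R

theorem IsLinearSubmodule.exists_matrix {ι : Type} [Fintype ι]
    {R : Submodule (MvPolynomial σ K) (ι → MvPolynomial σ K)} (h : IsLinearSubmodule R) :
    ∃ (κ : Type) (_ : Fintype κ) (D : Matrix ι κ (MvPolynomial σ K)),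
      (∀ i k, (D i k).IsHomogeneous 1) ∧ LinearMap.range D.mulVecLin = R ∧
        IsLinearSubmodule (LinearMap.ker D.mulVecLin) := by
  obtain ⟨P, hP, hR⟩ := h
  obtain ⟨κ, hκ, D, hD, hr, hk⟩ := hP ι R hR
  exact ⟨κ, hκ, D, hD, hr, P, hP, hk⟩

theorem isLinearSubmodule_range {ι κ : Type} [Fintype ι] [Fintype κ]
    (D : Matrix ι κ (MvPolynomial σ K)) (hD : ∀ i k, (D i k).IsHomogeneous 1)
    (h : IsLinearSubmodule (LinearMap.ker D.mulVecLin)) :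
    IsLinearSubmodule (LinearMap.range D.mulVecLin) := by
  refine ⟨fun ι _ R => ∃ (κ : Type) (_ : Fintype κ) (D : Matrix ι κ (MvPolynomial σ K)),
      (∀ i k, (D i k).IsHomogeneous 1) ∧ LinearMap.range D.mulVecLin = R ∧
        IsLinearSubmodule (LinearMap.ker D.mulVecLin), ?_, κ, inferInstance, D, hD, rfl, h⟩
  rintro ι _ R ⟨κ, hκ, D, hD, hr, hk⟩
  exact ⟨κ, hκ, D, hD, hr, hk.exists_matrix⟩

theorem isLinearSubmodule_bot {ι : Type} [Fintype ι] :
    IsLinearSubmodule (⊥ : Submodule (MvPolynomial σ K) (ι → MvPolynomial σ K)) := by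
  refine ⟨fun _ _ R => R = ⊥, ?_, rfl⟩
  rintro ι _ R rfl
  refine ⟨Empty, inferInstance, 0, fun _ k => k.elim, ?_, ?_⟩
  · ext x
    simp
  · exact Subsingleton.elim _ _

theorem homogeneousComponent_mul_of_isHomogeneous {d : ℕ} {l : MvPolynomial σ K}
    (hl : l.IsHomogeneous d) (k : ℕ) (x : MvPolynomial σ K) :
    homogeneousComponent (d + k) (l * x) = l * homogeneousComponent k x := by
  conv_lhs => rw [← sum_homogeneousComponent x, Finset.mul_sum, map_sum]
  have h : ∀ i, homogeneousComponent (d + k) (l * homogeneousComponent i x)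
      = if i = k then l * homogeneousComponent k x else 0 := by
    intro i
    rw [homogeneousComponent_of_mem (hl.mul (homogeneousComponent_isHomogeneous i x))]
    by_cases hik : i = k
    · simp [hik]
    · simp [hik, Ne.symm hik]
  simp only [h, Finset.sum_ite_eq', Finset.mem_range]
  split_ifs with hk
  · rfl
  · rw [homogeneousComponent_eq_zero _ _ (by omega), mul_zero]

/-- Closed under taking homogeneous components of the coordinates. -/
def IsGradedSubmodule {ι : Type} (R : Submodule (MvPolynomial σ K) (ι → MvPolynomial σ K)) :
    Prop :=
  ∀ r ∈ R, ∀ k, (fun i => homogeneousComponent k (r i)) ∈ R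

theorem isGradedSubmodule_ker {ι κ : Type} [Fintype κ] {d : ℕ}
    (D : Matrix ι κ (MvPolynomial σ K)) (hD : ∀ i k, (D i k).IsHomogeneous d) :
    IsGradedSubmodule (LinearMap.ker D.mulVecLin) := by
  intro r hr k
  rw [LinearMap.mem_ker] at hr ⊢
  ext1 i
  have h := congrArg (homogeneousComponent (d + k)) (congrFun hr i)
  simpa [Matrix.mulVec, dotProduct, homogeneousComponent_mul_of_isHomogeneous (hD _ _)] using h

/-- Graded submodules of `S^(α ⊕ β)` that are extensions of linear submodules. -/
inductive IsLinearExtension : ∀ (ι : Type) [Fintype ι],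
    Submodule (MvPolynomial σ K) (ι → MvPolynomial σ K) → Prop
  | mk {α β : Type} [Fintype α] [Fintype β]
    (R : Submodule (MvPolynomial σ K) (α ⊕ β → MvPolynomial σ K))
    (A : Submodule (MvPolynomial σ K) (α → MvPolynomial σ K))
    (C : Submodule (MvPolynomial σ K) (β → MvPolynomial σ K))
    (hR : IsGradedSubmodule R) (hA : IsLinearSubmodule A) (hC : IsLinearSubmodule C)
    (hRA : ∀ x, x ∈ A ↔ Sum.elim x 0 ∈ R)
    (hRC : ∀ y, y ∈ C ↔ ∃ x, Sum.elim x y ∈ R) : IsLinearExtension (α ⊕ β) R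

/-- One step of the horseshoe construction. The covers of `A` and `C` combine into a block
triangular cover of `R`, whose kernel is again an extension of the two kernels. Hence being an
extension is itself an invariant that certifies linearity. -/
theorem IsLinearExtension.exists_matrix (ι : Type) [Fintype ι]
    (R : Submodule (MvPolynomial σ K) (ι → MvPolynomial σ K)) (h : IsLinearExtension ι R) :
    ∃ (κ : Type) (_ : Fintype κ) (D : Matrix ι κ (MvPolynomial σ K)),
      (∀ i k, (D i k).IsHomogeneous 1) ∧ LinearMap.range D.mulVecLin = R ∧
        IsLinearExtension κ (LinearMap.ker D.mulVecLin) := by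
  classical
  obtain @⟨α, β, _, _, R, A, C, hR, hA, hC, hRA, hRC⟩ := h
  obtain ⟨κA, _, DA, hDA, rfl, hkA⟩ := hA.exists_matrix
  obtain ⟨κC, _, DC, hDC, rfl, hkC⟩ := hC.exists_matrix
  -- An arbitrary lift may be replaced by its degree-one component because `R` is graded; the lower
  -- block is already of degree one.
  have hlift : ∀ c : κC, ∃ x : α → MvPolynomial σ K, (∀ i, (x i).IsHomogeneous 1) ∧
      Sum.elim x (fun b => DC b c) ∈ R := by
    intro c
    obtain ⟨x, hx⟩ := (hRC (fun b => DC b c)).1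
      ⟨Pi.single c 1, by ext1 b; simp⟩
    refine ⟨fun i => homogeneousComponent 1 (x i),
      fun i => homogeneousComponent_isHomogeneous _ _, ?_⟩
    convert hR _ hx 1 using 1
    ext1 (i | b)
    · rfl
    · simp [homogeneousComponent_of_mem (hDC b c)]
  choose E hE hER using hlift
  set D : Matrix (α ⊕ β) (κA ⊕ κC) (MvPolynomial σ K) :=
    Matrix.fromBlocks DA (Matrix.of fun a c => E c a) 0 DC with hDdef
  have hDmul : ∀ x y, D.mulVec (Sum.elim x y) =
      Sum.elim (DA.mulVec x + (Matrix.of fun a c => E c a).mulVec y) (DC.mulVec y) := by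
    intro x y
    simp [hDdef, Matrix.fromBlocks_mulVec]
  have hDh : ∀ i k, (D i k).IsHomogeneous 1 := by
    rintro (i | i) (k | k)
    · exact hDA i k
    · exact hE k i
    · exact isHomogeneous_zero _ _ _
    · exact hDC i k
  have hEy : ∀ y, Sum.elim ((Matrix.of fun a c => E c a).mulVec y) (DC.mulVec y) ∈ R := by
    intro y
    have : Sum.elim ((Matrix.of fun a c => E c a).mulVec y) (DC.mulVec y)
        = ∑ c, y c • Sum.elim (E c) (fun b => DC b c) := by
      ext1 (i | b)
      · simp [Matrix.mulVec, dotProduct, Finset.sum_apply, mul_comm]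
      · simp [Matrix.mulVec, dotProduct, Finset.sum_apply, mul_comm]
    rw [this]
    exact Submodule.sum_mem _ fun c _ => Submodule.smul_mem _ _ (hER c)
  have hAx : ∀ x, Sum.elim (DA.mulVec x) 0 ∈ R := fun x => (hRA _).1 ⟨x, rfl⟩
  have hsum : ∀ (x x' : α → MvPolynomial σ K) (y y' : β → MvPolynomial σ K),
      Sum.elim (x + x') (y + y') = Sum.elim x y + Sum.elim x' y' := by
    intro x x' y y'
    ext1 (i | i) <;> rfl
  refine ⟨κA ⊕ κC, inferInstance, D, hDh, ?_, ?_⟩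
  · apply le_antisymm
    · rintro _ ⟨z, rfl⟩
      obtain ⟨x, y, rfl⟩ : ∃ x y, z = Sum.elim x y := ⟨_, _, (Sum.elim_comp_inl_inr z).symm⟩
      rw [Matrix.mulVecLin_apply, hDmul, ← zero_add (DC.mulVec y), hsum]
      exact R.add_mem (hAx x) (hEy y)
    · intro r hr
      obtain ⟨p, q, rfl⟩ : ∃ x y, r = Sum.elim x y := ⟨_, _, (Sum.elim_comp_inl_inr r).symm⟩
      obtain ⟨y, rfl⟩ := (hRC q).2 ⟨p, hr⟩
      have h2 := R.sub_mem hr (hEy y)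
      have h3 : p - (Matrix.of fun a c => E c a).mulVec y ∈ LinearMap.range DA.mulVecLin := by
        rw [hRA]
        convert h2 using 1
        ext1 (i | i) <;> simp
      obtain ⟨x, hx⟩ := h3
      refine ⟨Sum.elim x y, ?_⟩
      rw [Matrix.mulVecLin_apply, hDmul]
      rw [Matrix.mulVecLin_apply] at hx
      rw [hx]
      simp
  -- Every `y` in the kernel of `DC` lifts: its image under the off-diagonal block lies in `A`, the
  -- range of `DA`, and can be cancelled.
  · refine IsLinearExtension.mk _ _ _ (isGradedSubmodule_ker D hDh) hkA hkC ?_ ?_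
    · intro x
      rw [LinearMap.mem_ker, LinearMap.mem_ker, Matrix.mulVecLin_apply, Matrix.mulVecLin_apply,
        hDmul]
      simp only [Matrix.mulVec_zero, add_zero]
      constructor
      · intro h
        rw [h]
        ext1 (i | i) <;> rfl
      · intro h
        ext1 i
        exact congrFun h (Sum.inl i)
    · intro y
      simp only [LinearMap.mem_ker, Matrix.mulVecLin_apply, hDmul]
      constructor
      · intro h
        have h1 := hEy y
        rw [h] at h1
        obtain ⟨x, hx⟩ := (hRA _).2 h1
        refine ⟨-x, ?_⟩
        rw [Matrix.mulVec_neg, h, ← hx, Matrix.mulVecLin_apply]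
        ext1 (i | i) <;> simp
      · rintro ⟨x, hx⟩
        ext1 i
        exact congrFun hx (Sum.inr i)

theorem isLinearSubmodule_of_extension {α β : Type} [Fintype α] [Fintype β]
    {R : Submodule (MvPolynomial σ K) (α ⊕ β → MvPolynomial σ K)}
    {A : Submodule (MvPolynomial σ K) (α → MvPolynomial σ K)}
    {C : Submodule (MvPolynomial σ K) (β → MvPolynomial σ K)}
    (hR : IsGradedSubmodule R) (hA : IsLinearSubmodule A) (hC : IsLinearSubmodule C)
    (hRA : ∀ x, x ∈ A ↔ Sum.elim x 0 ∈ R)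
    (hRC : ∀ y, y ∈ C ↔ ∃ x, Sum.elim x y ∈ R) : IsLinearSubmodule R :=
  ⟨@IsLinearExtension σ K _, IsLinearExtension.exists_matrix, .mk R A C hR hA hC hRA hRC⟩

/-- An ideal as a submodule of `S^1`. -/
def Ideal.toUnitPi (I : Ideal (MvPolynomial σ K)) :
    Submodule (MvPolynomial σ K) (Unit → MvPolynomial σ K) :=
  Submodule.comap (LinearMap.proj ()) I

theorem Ideal.mem_toUnitPi {I : Ideal (MvPolynomial σ K)} {r : Unit → MvPolynomial σ K} :
    r ∈ I.toUnitPi ↔ r () ∈ I := Iff.rfl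

/-- Multiplying by `X x` leaves the exponents of the variables in `V` unchanged. -/
theorem mem_span_X_image_of_X_mul_mem {V : Set σ} {x : σ} (hx : x ∉ V) {c : MvPolynomial σ K}
    (h : c * X x ∈ Ideal.span (X '' V : Set (MvPolynomial σ K))) :
    c ∈ Ideal.span (X '' V : Set (MvPolynomial σ K)) := by
  classical
  rw [mem_ideal_span_X_image] at h ⊢
  intro m hm
  obtain ⟨i, hi, hne⟩ := h (m + Finsupp.single x 1) (by
    rw [mem_support_iff, coeff_mul_X]
    exact mem_support_iff.1 hm)
  refine ⟨i, hi, ?_⟩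
  have : x ≠ i := by rintro rfl; exact hx hi
  simpa [Finsupp.single_apply, this] using hne

/-- The Koszul resolution as an iterated mapping cone. The new variable is a nonzerodivisor modulo
the old ones, so its coefficients in relations form the old ideal, and the relation module extends
that ideal by the old relations. -/
theorem isLinearSubmodule_span_X (V : Finset σ) :
    IsLinearSubmodule (Ideal.span (X '' (V : Set σ) : Set (MvPolynomial σ K))).toUnitPi := by
  classical
  induction V using Finset.induction_on with
  | empty =>
    convert isLinearSubmodule_bot (σ := σ) (K := K) (ι := Unit) using 1
    ext r
    simp only [Ideal.mem_toUnitPi, Finset.coe_empty, Set.image_empty, Ideal.span_empty,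
      Submodule.mem_bot]
    exact ⟨fun h => funext fun _ => h, fun h => congrFun h ()⟩
  | insert x V hx ih =>
    obtain ⟨κ, _, D, hD, hr, hk⟩ := ih.exists_matrix
    set E : Matrix Unit (κ ⊕ Unit) (MvPolynomial σ K) :=
      Matrix.of fun u => Sum.elim (D u) (fun _ => X x) with hE
    have hEh : ∀ i k, (E i k).IsHomogeneous 1 := by
      rintro i (k | k)
      · exact hD i k
      · exact isHomogeneous_X _ _
    have hmul : ∀ y c, E.mulVec (Sum.elim y c) () = D.mulVec y () + c () * X x := by
      intro y c
      simp [hE, Matrix.mulVec, dotProduct, mul_comm]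
    have hmem : ∀ r : MvPolynomial σ K,
        r ∈ Ideal.span (X '' (V : Set σ) : Set (MvPolynomial σ K)) ↔ ∃ y, D.mulVec y () = r := by
      intro r
      have : (fun _ : Unit => r) ∈ LinearMap.range D.mulVecLin ↔
          r ∈ Ideal.span (X '' (V : Set σ) : Set (MvPolynomial σ K)) := by
        rw [hr]
        exact Iff.rfl
      rw [← this]
      constructor
      · rintro ⟨y, hy⟩
        exact ⟨y, congrFun hy ()⟩
      · rintro ⟨y, hy⟩
        exact ⟨y, funext fun _ => hy⟩
    have hrange : LinearMap.range E.mulVecLin =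
        (Ideal.span (X '' ((insert x V : Finset σ) : Set σ) :
          Set (MvPolynomial σ K))).toUnitPi := by
      ext r
      rw [Ideal.mem_toUnitPi, Finset.coe_insert, Set.image_insert_eq, Ideal.mem_span_insert]
      constructor
      · rintro ⟨z, rfl⟩
        obtain ⟨y, c, rfl⟩ : ∃ y c, z = Sum.elim y c := ⟨_, _, (Sum.elim_comp_inl_inr z).symm⟩
        refine ⟨c (), _, (hmem _).2 ⟨y, rfl⟩, ?_⟩
        rw [Matrix.mulVecLin_apply, hmul, add_comm]
      · rintro ⟨c, z, hz, hrz⟩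
        obtain ⟨y, rfl⟩ := (hmem z).1 hz
        refine ⟨Sum.elim y (fun _ => c), funext fun _ => ?_⟩
        rw [Matrix.mulVecLin_apply, hmul, hrz, add_comm]
    rw [← hrange]
    refine isLinearSubmodule_range E hEh
      (isLinearSubmodule_of_extension (isGradedSubmodule_ker E hEh) hk ih ?_ ?_)
    · intro y
      rw [LinearMap.mem_ker, LinearMap.mem_ker, _root_.funext_iff, _root_.funext_iff]
      refine forall_congr' fun _ => ?_
      simp [hmul]
    · intro c
      rw [Ideal.mem_toUnitPi]
      simp only [LinearMap.mem_ker, Matrix.mulVecLin_apply, _root_.funext_iff]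
      constructor
      · intro hc
        obtain ⟨y, hy⟩ := (hmem (c () * X x)).1 (Ideal.mul_mem_right _ _ hc)
        refine ⟨-y, fun _ => ?_⟩
        rw [hmul, Matrix.mulVec_neg, Pi.neg_apply, hy]
        simp
      · rintro ⟨y, hy⟩
        have h := hy ()
        rw [hmul] at h
        refine mem_span_X_image_of_X_mul_mem (by simpa using hx) ((hmem _).2 ⟨-y, ?_⟩)
        rw [Matrix.mulVec_neg, Pi.neg_apply]
        exact (eq_neg_of_add_eq_zero_right h).symm

end LinearRelations

/-! ### From coinductive linearity to an actual resolution. -/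

section Resolution

variable {σ : Type*} {K : Type*} [Field K]

variable (σ K) in
/-- A linear submodule together with its ambient free module. -/
structure LinearStage where
  ι : Type
  fintype : Fintype ι
  R : Submodule (MvPolynomial σ K) (ι → MvPolynomial σ K)
  linear : IsLinearSubmodule R

attribute [instance] LinearStage.fintype

theorem LinearStage.exists_next (s : LinearStage σ K) : ∃ (t : LinearStage σ K)
    (D : Matrix s.ι t.ι (MvPolynomial σ K)), (∀ i k, (D i k).IsHomogeneous 1) ∧
      LinearMap.range D.mulVecLin = s.R ∧ LinearMap.ker D.mulVecLin = t.R := by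
  obtain ⟨κ, h, D, hD, hr, hk⟩ := s.linear.exists_matrix
  exact ⟨⟨κ, h, _, hk⟩, D, hD, hr, rfl⟩

/-- The successive linear syzygy modules. -/
def LinearStage.iterate (s : LinearStage σ K) : ℕ → LinearStage σ K
  | 0 => s
  | i + 1 => (s.iterate i).exists_next.choose

theorem hasLinearFreeResolution_of_isLinearSubmodule {ι : Type} [Fintype ι] {d : ℕ}
    (g : ι → MvPolynomial σ K) (hg : ∀ i, (g i).IsHomogeneous d)
    (h : IsLinearSubmodule (LinearMap.ker (Fintype.linearCombination (MvPolynomial σ K) g))) :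
    HasLinearFreeResolution (Ideal.span (Set.range g)) := by
  let s : LinearStage σ K := ⟨ι, inferInstance, _, h⟩
  have H := fun i => (s.iterate i).exists_next.choose_spec.choose_spec
  exact ⟨d, ⟨{
    ι := fun i => (s.iterate i).ι
    finite_rank := fun i => (s.iterate i).fintype
    gen := g
    diff := fun i => (s.iterate i).exists_next.choose_spec.choose
    gen_isHomogeneous := hg
    diff_isHomogeneous := fun i => (H i).1
    span_gen := rfl
    exact_zero := LinearMap.exact_iff.2 (H 0).2.1.symm
    exact_succ := fun i => LinearMap.exact_iff.2 ((H i).2.2.trans (H (i + 1)).2.1.symm) }⟩⟩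

end Resolution

/-! ### Linear quotients and the lexicographic exchange criterion. -/

section LinearQuotients

variable {σ : Type*} {K : Type*} [Field K]

variable (K) in
/-- The ideal generated by the monomials with exponents in a given set. -/
def monomialSpan (G : Set (σ →₀ ℕ)) : Ideal (MvPolynomial σ K) :=
  Ideal.span ((fun a => monomial a (1 : K)) '' G)

variable (K) in
/-- The monomials with exponents `e` satisfy only relations with a linear resolution. -/
def HasLinearRelations {ι : Type} [Fintype ι] (e : ι → σ →₀ ℕ) : Prop :=
  IsLinearSubmodule (LinearMap.ker (Fintype.linearCombination (MvPolynomial σ K)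
    fun i => monomial (e i) (1 : K)))

theorem isGradedSubmodule_ker_linearCombination {ι : Type} [Fintype ι] {d : ℕ}
    (g : ι → MvPolynomial σ K) (hg : ∀ i, (g i).IsHomogeneous d) :
    IsGradedSubmodule (LinearMap.ker (Fintype.linearCombination (MvPolynomial σ K) g)) := by
  intro r hr k
  rw [LinearMap.mem_ker, Fintype.linearCombination_apply] at hr ⊢
  have h := congrArg (homogeneousComponent (d + k)) hr
  simp only [smul_eq_mul, map_sum, map_zero] at h ⊢
  rw [← h]
  refine Finset.sum_congr rfl fun i _ => ?_
  rw [mul_comm (r i), homogeneousComponent_mul_of_isHomogeneous (hg i), mul_comm]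

/-- The coefficients of `m` in relations form the colon ideal of the old monomials by `m`. By `hm`
this is generated by the variables in `V`, so the new relation module extends a linear ideal by the
old relations. -/
theorem HasLinearRelations.insert [Finite σ] {ι : Type} [Fintype ι] {d : ℕ} {e : ι → σ →₀ ℕ}
    (he : HasLinearRelations K e) (m : σ →₀ ℕ) (hed : ∀ i, (e i).degree = d)
    (hmd : m.degree = d)
    (hm : ∀ i, ∃ v, m v < e i v ∧ ∃ j, e j ≤ m + Finsupp.single v 1) :
    HasLinearRelations K (Sum.elim e fun _ : Unit => m) := by
  classical
  have := Fintype.ofFinite σ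
  let V : Finset σ := Finset.univ.filter fun v => ∃ j, e j ≤ m + Finsupp.single v 1
  have hcolon : ∀ c : MvPolynomial σ K,
      c ∈ Ideal.span (X '' (V : Set σ) : Set (MvPolynomial σ K)) ↔
        c * monomial m 1 ∈ Ideal.span (Set.range fun i => monomial (e i) (1 : K)) := by
    intro c
    have hrange : Set.range (fun i => monomial (e i) (1 : K))
        = (fun a => monomial a (1 : K)) '' Set.range e := by
      rw [← Set.range_comp]; rfl
    rw [hrange, mem_ideal_span_X_image, mem_ideal_span_monomial_image]
    constructor
    · intro h u hu
      have hmu : m ≤ u ∧ u - m ∈ c.support := by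
        rw [mem_support_iff, coeff_mul_monomial'] at hu
        split_ifs at hu with hmu
        · exact ⟨hmu, by simpa [mem_support_iff] using hu⟩
        · exact absurd rfl hu
      obtain ⟨v, hv, hne⟩ := h _ hmu.2
      obtain ⟨j, hj⟩ := (Finset.mem_filter.1 hv).2
      refine ⟨e j, ⟨j, rfl⟩, hj.trans ?_⟩
      rw [Finsupp.tsub_apply] at hne
      intro w
      have hw := hmu.1 w
      rw [Finsupp.add_apply, Finsupp.single_apply]
      split_ifs with hvw
      · subst hvw; omega
      · omega
    · intro h u hu
      obtain ⟨_, ⟨i, rfl⟩, hi⟩ := h (u + m) (by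
        rw [mem_support_iff, coeff_mul_monomial, mul_one]
        exact mem_support_iff.1 hu)
      obtain ⟨v, hv, hj⟩ := hm i
      refine ⟨v, Finset.mem_filter.2 ⟨Finset.mem_univ _, hj⟩, ?_⟩
      have := hi v
      rw [Finsupp.add_apply] at this
      omega
  have hmon : ∀ a : σ →₀ ℕ, a.degree = d → (monomial a (1 : K)).IsHomogeneous d :=
    fun a ha => isHomogeneous_monomial _ ha
  have hlc : ∀ (x : ι → MvPolynomial σ K) (y : Unit → MvPolynomial σ K),
      Fintype.linearCombination (MvPolynomial σ K)
        (fun i => monomial (Sum.elim e (fun _ : Unit => m) i) (1 : K)) (Sum.elim x y) =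
      Fintype.linearCombination (MvPolynomial σ K) (fun i => monomial (e i) (1 : K)) x
        + y () * monomial m 1 := by
    intro x y
    simp [Fintype.linearCombination_apply]
  refine isLinearSubmodule_of_extension
    (isGradedSubmodule_ker_linearCombination (d := d) _ ?_) he (isLinearSubmodule_span_X V) ?_ ?_
  · rintro (i | i)
    · exact hmon _ (hed i)
    · exact hmon _ hmd
  · intro x
    rw [LinearMap.mem_ker, LinearMap.mem_ker, hlc]
    simp
  · intro y
    rw [Ideal.mem_toUnitPi, hcolon, Ideal.span, ← Fintype.range_linearCombination]
    simp only [LinearMap.mem_ker, hlc, LinearMap.mem_range]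
    constructor
    · rintro ⟨x, hx⟩
      exact ⟨-x, by rw [map_neg, hx, neg_add_cancel]⟩
    · rintro ⟨x, hx⟩
      exact ⟨-x, by rw [map_neg]; exact (eq_neg_of_add_eq_zero_right hx).symm⟩

theorem hasLinearRelations_of_isEmpty {ι : Type} [Fintype ι] [IsEmpty ι] (e : ι → σ →₀ ℕ) :
    HasLinearRelations K e := by
  unfold HasLinearRelations
  convert isLinearSubmodule_bot (σ := σ) (K := K) (ι := ι) using 1
  exact Subsingleton.elim _ _

/-- A finite set of exponents of the same degree with the weak exchange property: if `β` is larger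
than `α` in the lexicographic order and they first differ at `v`, then `α + e_v - e_k` belongs to
the set for some `k > v`. The generated ideal then has a linear resolution. -/
theorem hasLinearFreeResolution_monomialSpan {n d : ℕ} (G : Set (Fin n →₀ ℕ))
    (hd : ∀ α ∈ G, α.degree = d)
    (hG : ∀ α ∈ G, ∀ β ∈ G, ∀ v, (∀ w < v, α w = β w) → α v < β v →
      ∃ γ ∈ G, (∀ w < v, γ w = α w) ∧ α v < γ v ∧ γ ≤ α + Finsupp.single v 1) :
    HasLinearFreeResolution (monomialSpan K G) := by
  classical
  have hfin : G.Finite := by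
    refine (Set.finite_Iic (Finsupp.equivFunOnFinite.symm fun _ : Fin n => d)).subset ?_
    intro α hα v
    have := Finsupp.le_degree v α
    rw [hd α hα] at this
    simpa using this
  have hex : ∀ α ∈ G, ∀ β ∈ G, toLex α < toLex β → ∃ v, α v < β v ∧
      ∃ γ ∈ G, toLex α < toLex γ ∧ γ ≤ α + Finsupp.single v 1 := by
    intro α hα β hβ hlt
    obtain ⟨v, hv, hlt⟩ := Finsupp.Lex.lt_iff.1 hlt
    obtain ⟨γ, hγ, h1, h2, h3⟩ := hG α hα β hβ v hv hlt
    exact ⟨v, hlt, γ, hγ, Finsupp.Lex.lt_iff.2 ⟨v, fun w hw => (h1 w hw).symm, h2⟩, h3⟩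
  -- Induction over upper sets of `G`, inserting a new minimum each time. Upward closure puts the
  -- monomial supplied by exchange among those already listed.
  have key : ∀ F : Finset (Lex (Fin n →₀ ℕ)), (∀ x ∈ F, ofLex x ∈ G) →
      (∀ g, ofLex g ∈ G → ∀ x ∈ F, x ≤ g → g ∈ F) →
      ∃ (ι : Type) (_ : Fintype ι) (e : ι → Fin n →₀ ℕ),
        (∀ a, toLex a ∈ F ↔ a ∈ Set.range e) ∧ HasLinearRelations K e := by
    intro F
    induction F using Finset.induction_on_min with
    | empty =>
      intro _ _
      exact ⟨Empty, inferInstance, Empty.elim, by simp, hasLinearRelations_of_isEmpty _⟩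
    | insert a F ha ih =>
      intro hF hup
      have haG : ofLex a ∈ G := hF a (Finset.mem_insert_self _ _)
      obtain ⟨ι, _, e, he, hl⟩ := ih (fun x hx => hF x (Finset.mem_insert_of_mem hx))
        (fun g hg x hx hxg => Finset.mem_of_mem_insert_of_ne
          (hup g hg x (Finset.mem_insert_of_mem hx) hxg) ((ha x hx).trans_le hxg).ne')
      have heF : ∀ i, toLex (e i) ∈ F := fun i => (he _).2 ⟨i, rfl⟩
      have heG : ∀ i, e i ∈ G := fun i => hF _ (Finset.mem_insert_of_mem (heF i))
      refine ⟨ι ⊕ Unit, inferInstance, Sum.elim e fun _ => ofLex a, ?_,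
        hl.insert (ofLex a) (fun i => hd _ (heG i)) (hd _ haG) ?_⟩
      · intro b
        rw [Finset.mem_insert, he, Set.Sum.elim_range, Set.mem_union, or_comm]
        refine or_congr Iff.rfl ?_
        simp only [Set.mem_range, exists_const]
        exact ⟨fun h => h ▸ rfl, fun h => h ▸ rfl⟩
      · intro i
        obtain ⟨v, hv, γ, hγ, h1, h2⟩ := hex _ haG _ (heG i) (ha _ (heF i))
        have hγF : toLex γ ∈ F := Finset.mem_of_mem_insert_of_ne
          (hup (toLex γ) hγ a (Finset.mem_insert_self _ _) h1.le) h1.ne'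
        obtain ⟨j, rfl⟩ := (he γ).1 hγF
        exact ⟨v, hv, j, h2⟩
  obtain ⟨ι, _, e, he, hl⟩ := key (hfin.toFinset.map toLex.toEmbedding)
    (by simp) (by
      intro g hg _ _ _
      simpa using hg)
  have heG : G = Set.range e := by
    ext a
    rw [← he a]
    simp
  have hspan : monomialSpan K G = Ideal.span (Set.range fun i => monomial (e i) (1 : K)) := by
    rw [monomialSpan, heG, ← Set.range_comp]
    rfl
  rw [hspan]
  exact hasLinearFreeResolution_of_isLinearSubmodule _
    (fun i => isHomogeneous_monomial _ (hd _ (heG ▸ ⟨i, rfl⟩))) hl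

end LinearQuotients

/-! ### Edge multiplicities on the cycle and their exchange property. -/

section Exchange

/-- The exponents of a product of the generators with multiplicities `a`, where `a w` counts the
edge `{w - 1, w}` of the `n`-cycle, each generator being complementary to an edge.
For `ε = 0`, the number `- a 0` counts factors `x_0` instead, and `T + a 0` counts
factors `x_{n - 1}`. -/
def cycleExponent (n : ℕ) (ε N T : ℤ) (a : ℕ → ℤ) (v : ℕ) : ℤ :=
  if v + 1 = n then N + T - a v + (1 - 2 * ε) * a 0 else N - a v - a (v + 1)

/-- The multiplicities that occur. -/
structure IsMultiplicity (n : ℕ) (ε N lo hi : ℤ) (a : ℕ → ℤ) : Prop where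
  lo_le : lo ≤ a 0
  le_hi : a 0 ≤ hi
  nonneg : ∀ v, 0 < v → v < n → 0 ≤ a v
  sum_eq : ∑ v ∈ Finset.range n, a v + (ε - 1) * a 0 = N

theorem sum_cycleExponent {n : ℕ} (hn : 0 < n) {ε N T lo hi : ℤ} {a : ℕ → ℤ}
    (ha : IsMultiplicity n ε N lo hi a) :
    ∑ v ∈ Finset.range n, cycleExponent n ε N T a v = (n - 2) * N + T := by
  obtain ⟨m, rfl⟩ : ∃ m, n = m + 1 := ⟨n - 1, by omega⟩
  have h := ha.sum_eq
  have h' := h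
  rw [Finset.sum_range_succ] at h
  rw [Finset.sum_range_succ'] at h'
  rw [Finset.sum_range_succ]
  have h1 : ∀ v ∈ Finset.range m, cycleExponent (m + 1) ε N T a v = N - a v - a (v + 1) := by
    intro v hv
    rw [cycleExponent, if_neg (by have := Finset.mem_range.1 hv; omega)]
  rw [Finset.sum_congr rfl h1, cycleExponent, if_pos rfl, Finset.sum_sub_distrib,
    Finset.sum_sub_distrib, Finset.sum_const, Finset.card_range, nsmul_eq_mul]
  push_cast
  linear_combination -h - h'

theorem sum_alternating (w : ℕ) :
    ∑ v ∈ Finset.range (w + 1), (if Even (w + v) then (-1 : ℤ) else 1) =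
      if Even w then -1 else 0 := by
  induction w with
  | zero => simp
  | succ w ih =>
    rw [Finset.sum_range_succ]
    have h : ∀ v ∈ Finset.range (w + 1), (if Even (w + 1 + v) then (-1 : ℤ) else 1) =
        -(if Even (w + v) then (-1 : ℤ) else 1) := by
      intro v _
      by_cases hv : Even (w + v) <;>
        simp [hv, show w + 1 + v = w + v + 1 by ring, Nat.even_add_one]
    rw [Finset.sum_congr rfl h, Finset.sum_neg_distrib, ih]
    by_cases hw : Even w <;> simp [hw, Nat.even_add_one]

theorem sum_alternating_range {w n : ℕ} (h : w < n) :
    ∑ v ∈ Finset.range n, (if v ≤ w then (if Even (w + v) then (-1 : ℤ) else 1) else 0) =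
      if Even w then -1 else 0 := by
  rw [← sum_alternating w, ← Finset.sum_filter]
  refine Finset.sum_congr ?_ fun _ _ => rfl
  ext v
  simp only [Finset.mem_filter, Finset.mem_range]
  omega

theorem eq_alternating {d : ℕ → ℤ} {w : ℕ} (h : ∀ v < w, d v + d (v + 1) = 0) :
    ∀ v ≤ w, d v = if Even v then d 0 else - d 0 := by
  intro v
  induction v with
  | zero => simp
  | succ v ih =>
    intro hv
    have h1 := h v hv
    rw [ih (by omega)] at h1
    by_cases hv : Even v <;> simp [hv, Nat.even_add_one] at h1 ⊢ <;> linarith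

/-- Equality of the exponents before `w` makes `b - a` alternate on `0, …, w`. The new vector `c`
either slides one edge to the right past vertex `w`, or takes a unit step from `a` towards `b` on
`0, …, w`. -/
theorem exists_exchange {n : ℕ} {ε N T lo hi : ℤ} (hε : ε = 0 ∨ ε = 1) {a b : ℕ → ℤ}
    (ha : IsMultiplicity n ε N lo hi a) (hb : IsMultiplicity n ε N lo hi b) {w : ℕ} (hw : w < n)
    (heq : ∀ v < w, cycleExponent n ε N T a v = cycleExponent n ε N T b v)
    (hlt : cycleExponent n ε N T a w < cycleExponent n ε N T b w) :
    ∃ c, IsMultiplicity n ε N lo hi c ∧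
      (∀ v < n, v ≠ w → cycleExponent n ε N T c v ≤ cycleExponent n ε N T a v) ∧
      (∀ v < w, cycleExponent n ε N T c v = cycleExponent n ε N T a v) ∧
      cycleExponent n ε N T c w = cycleExponent n ε N T a w + 1 := by
  -- Both exponent vectors have the same sum, so they cannot differ only in the last place.
  have hwn : w + 1 < n := by
    by_contra hcon
    obtain rfl : n = w + 1 := by omega
    have h1 := sum_cycleExponent (T := T) w.succ_pos ha
    have h2 := sum_cycleExponent (T := T) w.succ_pos hb
    rw [Finset.sum_range_succ] at h1 h2
    rw [Finset.sum_congr rfl fun v hv => heq v (Finset.mem_range.1 hv)] at h1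
    linarith
  have hd : ∀ v < w, (b v - a v) + (b (v + 1) - a (v + 1)) = 0 := by
    intro v hv
    have := heq v hv
    simp only [cycleExponent, if_neg (show ¬ v + 1 = n by omega)] at this
    linarith
  have hdw : (b w - a w) + (b (w + 1) - a (w + 1)) < 0 := by
    simp only [cycleExponent, if_neg (show ¬ w + 1 = n by omega)] at hlt
    linarith
  have halt := eq_alternating (d := fun v => b v - a v) hd
  -- Replacing the edge `{w, w + 1}` by `{w + 1, w + 2}` raises the exponent at `w` and lowers the
  -- one at `w + 2`.
  by_cases hshift : 0 < a (w + 1) ∧ w + 2 < n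
  · obtain ⟨hpos, hw2⟩ := hshift
    refine ⟨fun v => a v + ((if v = w + 2 then 1 else 0) - if v = w + 1 then 1 else 0),
      ⟨?_, ?_, ?_, ?_⟩, ?_, ?_, ?_⟩
    · simpa using ha.lo_le
    · simpa using ha.le_hi
    · intro v h0 hv
      have := ha.nonneg v h0 hv
      split_ifs with h1 h2 h2 <;> subst_vars <;> omega
    · have h := ha.sum_eq
      rw [Finset.sum_add_distrib, Finset.sum_sub_distrib, Finset.sum_ite_eq', Finset.sum_ite_eq',
        if_pos (Finset.mem_range.2 hw2), if_pos (Finset.mem_range.2 hwn)]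
      simpa using h
    · intro v hv hvw
      simp only [cycleExponent]
      rcases hε with rfl | rfl <;> split_ifs <;> omega
    · intro v hv
      simp only [cycleExponent]
      rcases hε with rfl | rfl <;> split_ifs <;> omega
    · simp only [cycleExponent]
      rcases hε with rfl | rfl <;> split_ifs <;> omega
  -- If `w + 2 < n`, then `a (w + 1)` vanishes and the strict inequality forces `b w < a w`. If `w +
  -- 2 = n`, the sum condition expresses the last difference through `b 0 - a 0`, and the sign also
  -- ties `ε` to the parity of `w`.
  · have hdef : b w < a w ∧ (w + 2 = n → (Even w → ε = 0) ∧ (¬ Even w → ε = 1)) := by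
      by_cases hw2 : w + 2 = n
      · have hsum : ∑ v ∈ Finset.range (w + 1), (b v - a v) =
            if Even w then b 0 - a 0 else 0 := by
          have h1 : ∀ v ∈ Finset.range (w + 1), b v - a v =
              (if Even (w + v) then (-1 : ℤ) else 1) *
                (if Even w then -(b 0 - a 0) else b 0 - a 0) := by
            intro v hv
            rw [halt v (by have := Finset.mem_range.1 hv; omega)]
            by_cases hv : Even v <;> by_cases hw : Even w <;> simp [hv, hw, Nat.even_add]
          rw [Finset.sum_congr rfl h1, ← Finset.sum_mul, sum_alternating]
          by_cases hw : Even w <;> simp [hw]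
        have h1 := ha.sum_eq
        have h2 := hb.sum_eq
        rw [← hw2, Finset.sum_range_succ] at h1 h2
        rw [Finset.sum_sub_distrib] at hsum
        have hw' := halt w le_rfl
        by_cases hev : Even w <;> rcases hε with rfl | rfl <;>
          simp only [hev, if_true, if_false] at hsum hw' <;>
          simp [hev] <;> omega
      · refine ⟨?_, fun h => absurd h hw2⟩
        have h1 : ¬ 0 < a (w + 1) := fun h => hshift ⟨h, by omega⟩
        have h2 := hb.nonneg (w + 1) (by omega) hwn
        linarith
    obtain ⟨hneg, hend⟩ := hdef
    have hw' := halt w le_rfl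
    -- The correction at `n - 1` that restores the sum condition after adding `p`. It vanishes when
    -- `w + 2 = n`, where it would spoil the exponent at `w`.
    obtain ⟨r, hr⟩ : ∃ r : ℤ, r = if Even w then ε else 1 - ε := ⟨_, rfl⟩
    have hr0 : 0 ≤ r := by rcases hε with rfl | rfl <;> split_ifs at hr <;> omega
    have hr1 : w + 2 = n → r = 0 := by
      intro h
      have := hend h
      by_cases hev : Even w <;> simp [hev] at this hr <;> omega
    -- The signs of `p` are those of `b - a`, which is nonzero on `0, …, w`. Thus `a + p` stays
    -- between `a` and `b` there and inherits the bounds and nonnegativity.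
    obtain ⟨p, hp⟩ : ∃ p : ℕ → ℤ,
      p = fun v => if v ≤ w then (if Even (w + v) then (-1 : ℤ) else 1) else 0 := ⟨_, rfl⟩
    have hp0 : p 0 = if Even w then -1 else 1 := by simp [hp]
    have hpw : p w = -1 := by simp [hp]
    have hpgt : ∀ v, w < v → p v = 0 := fun v hv => by simp [hp, hv]
    have hpsucc : ∀ v < w, p v + p (v + 1) = 0 := by
      intro v hv
      simp only [hp, if_pos hv.le, if_pos (Nat.succ_le_of_lt hv)]
      by_cases h : Even (w + v) <;> simp [h, ← add_assoc, Nat.even_add_one]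
    have hpsum : ∑ v ∈ Finset.range n, p v = if Even w then -1 else 0 := by
      rw [hp]
      exact sum_alternating_range hw
    refine ⟨fun v => a v + (p v + if v = n - 1 then r else 0), ⟨?_, ?_, ?_, ?_⟩, ?_, ?_, ?_⟩
    · have h1 := ha.lo_le
      have h2 := hb.lo_le
      simp only [if_neg (show ¬ 0 = n - 1 by omega), hp0]
      split_ifs at hw' ⊢ <;> omega
    · have h1 := ha.le_hi
      have h2 := hb.le_hi
      simp only [if_neg (show ¬ 0 = n - 1 by omega), hp0]
      split_ifs at hw' ⊢ <;> omega
    · intro v h0 hv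
      have h1 := ha.nonneg v h0 hv
      have h2 := hb.nonneg v h0 hv
      suffices h : 0 ≤ a v + p v by
        split_ifs <;> omega
      by_cases hvw : v ≤ w
      · have h3 := halt v hvw
        simp only [hp, if_pos hvw]
        by_cases hev : Even v <;> by_cases hew : Even w <;>
          simp only [hev, hew, if_true, if_false, Nat.even_add, iff_true, iff_false,
            not_true] at h3 hw' ⊢ <;> omega
      · rw [hpgt v (by omega)]
        omega
    · have h := ha.sum_eq
      rw [Finset.sum_add_distrib, Finset.sum_add_distrib, hpsum, Finset.sum_ite_eq',
        if_pos (Finset.mem_range.2 (by omega)), if_neg (show ¬ 0 = n - 1 by omega), hp0, hr]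
      split_ifs <;> linear_combination h
    -- The last exponent changes by `ε - 1` for even `w` and by `-ε` for odd `w`, never upwards.
    · intro v hv hvw
      have h1 := hpsucc v
      have h2 := hpgt v
      have h3 := hpgt (v + 1)
      simp only [cycleExponent, if_neg (show ¬ 0 = n - 1 by omega), hp0]
      rcases hε with rfl | rfl <;> split_ifs at hr ⊢ <;> omega
    · intro v hv
      have h1 := hpsucc v hv
      simp only [cycleExponent, if_neg (show ¬ v + 1 = n by omega),
        if_neg (show ¬ v = n - 1 by omega), if_neg (show ¬ v + 1 = n - 1 by omega)]
      omega
    · have h1 := hpgt (w + 1) (by omega)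
      simp only [cycleExponent, if_neg (show ¬ w + 1 = n by omega),
        if_neg (show ¬ w = n - 1 by omega), hpw, h1]
      split_ifs
      · rw [hr1 (by omega)]; ring
      · ring

end Exchange

/-! ### The ideals `B` and `C` as spans of cycle exponents. -/

section CycleIdeals

open Pointwise

variable {K : Type*} [Field K]

theorem monomialSpan_mul {σ : Type*} (P Q : Set (σ →₀ ℕ)) :
    monomialSpan K P * monomialSpan K Q = monomialSpan K (P + Q) := by
  rw [monomialSpan, monomialSpan, monomialSpan, Ideal.span_mul_span']
  congr 1
  ext x
  simp only [Set.mem_mul, Set.mem_image, Set.mem_add]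
  constructor
  · rintro ⟨_, ⟨a, ha, rfl⟩, _, ⟨b, hb, rfl⟩, rfl⟩
    exact ⟨a + b, ⟨a, ha, b, hb, rfl⟩, by simp [monomial_mul]⟩
  · rintro ⟨_, ⟨a, ha, b, hb, rfl⟩, rfl⟩
    exact ⟨_, ⟨a, ha, rfl⟩, _, ⟨b, hb, rfl⟩, by simp [monomial_mul]⟩

/-- The exponent of `pathMonomial K n i`. -/
def pathExponent (n : ℕ) (i : Fin n) : Fin n →₀ ℕ :=
  ∑ k ∈ Finset.range (n - 2), Finsupp.single ⟨(i.val + k) % n, Nat.mod_lt _ i.pos⟩ 1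

theorem pathMonomial_eq_monomial (n : ℕ) (i : Fin n) :
    pathMonomial K n i = monomial (pathExponent n i) 1 := by
  rw [pathExponent, monomial_sum_one]
  rfl

theorem pathExponent_apply {n w : ℕ} (hn : 2 ≤ n) (hw : w < n) {i : Fin n}
    (hi : i.val = (w + 1) % n) (v : Fin n) :
    (pathExponent n i v : ℤ) = cycleExponent n 1 1 0 (fun u => if u = w then 1 else 0) v := by
  -- The cyclic distance from `i` to `v`; the variable at `v` occurs exactly when it is below `n -
  -- 2`.
  obtain ⟨k₀, hk₀⟩ : ∃ k₀ : ℕ, k₀ = if i.val ≤ v.val then v.val - i.val else v.val + n - i.val :=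
    ⟨_, rfl⟩
  have hiff : ∀ k ∈ Finset.range (n - 2),
      (Finsupp.single (⟨(i.val + k) % n, Nat.mod_lt _ i.pos⟩ : Fin n) 1 : Fin n →₀ ℕ) v =
        if k = k₀ then 1 else 0 := by
    intro k hk
    rw [Finset.mem_range] at hk
    rw [Finsupp.single_apply]
    refine if_congr (Fin.ext_iff.trans ?_) rfl rfl
    simp only
    have h1 := i.isLt
    have h2 := v.isLt
    by_cases h : i.val + k < n
    · rw [Nat.mod_eq_of_lt h]
      split_ifs at hk₀ <;> omega
    · rw [Nat.mod_eq_sub_mod (by omega), Nat.mod_eq_of_lt (by omega)]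
      split_ifs at hk₀ <;> omega
  have hval : pathExponent n i v = if k₀ < n - 2 then 1 else 0 := by
    rw [pathExponent, Finsupp.finsetSum_apply, Finset.sum_congr rfl hiff, Finset.sum_ite_eq']
    simp only [Finset.mem_range]
  have hi' : i.val = if w + 1 = n then 0 else w + 1 := by
    split_ifs with h
    · rw [hi, h, Nat.mod_self]
    · rw [hi, Nat.mod_eq_of_lt (by omega)]
  have h2 := v.isLt
  rw [hval, cycleExponent]
  split_ifs at * <;> push_cast <;> omega

theorem cycleExponent_add (n : ℕ) (ε N N' T T' : ℤ) (a a' : ℕ → ℤ) (v : ℕ) :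
    cycleExponent n ε (N + N') (T + T') (fun u => a u + a' u) v =
      cycleExponent n ε N T a v + cycleExponent n ε N' T' a' v := by
  unfold cycleExponent
  split_ifs <;> ring

/-- The parameters for products of powers of path ideals (`ε = 1`), or of `J_n` and
`(x_0, x_{n - 1})` (`ε = 0`). -/
def IsAdmissible (ε T lo hi : ℤ) : Prop :=
  ε = 1 ∧ T = 0 ∧ 0 ≤ lo ∨ ε = 0 ∧ T = - lo ∧ hi ≤ 0

theorem cycleExponent_nonneg {n : ℕ} (hn : 2 ≤ n) {ε N T lo hi : ℤ}
    (hε : IsAdmissible ε T lo hi) {a : ℕ → ℤ} (ha : IsMultiplicity n ε N lo hi a) {v : ℕ}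
    (hv : v < n) : 0 ≤ cycleExponent n ε N T a v := by
  have hlo := ha.lo_le
  have hhi := ha.le_hi
  -- The genuine edge multiplicities: nonnegative with total `N`, so any two sum to at most `N`. For
  -- `ε = 0` the end factors `-a 0` and `T + a 0` are nonnegative separately.
  obtain ⟨b, hb⟩ : ∃ b : ℕ → ℤ, b = fun u => if u = 0 then ε * a 0 else a u := ⟨_, rfl⟩
  have hb0 : b 0 = ε * a 0 := by simp [hb]
  have hbs : ∀ u, u ≠ 0 → b u = a u := fun u hu => by simp [hb, hu]
  have hbn : ∀ u < n, 0 ≤ b u := by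
    intro u hu
    rcases Nat.eq_zero_or_pos u with rfl | h
    · rw [hb0]
      rcases hε with ⟨rfl, _, _⟩ | ⟨rfl, _, _⟩ <;> omega
    · rw [hbs u h.ne']
      exact ha.nonneg u h hu
  have hsum : ∑ u ∈ Finset.range n, b u = N := by
    obtain ⟨m, rfl⟩ : ∃ m, n = m + 1 := ⟨n - 1, by omega⟩
    have h := ha.sum_eq
    rw [Finset.sum_range_succ'] at h ⊢
    rw [hb0, Finset.sum_congr rfl fun u _ => hbs (u + 1) (by omega)]
    linear_combination h
  have hpair : ∀ u < n, ∀ u' < n, u ≠ u' → b u + b u' ≤ N := by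
    intro u hu u' hu' hne
    rw [← hsum]
    exact Finset.add_le_sum (fun i hi => hbn i (Finset.mem_range.1 hi)) (Finset.mem_range.2 hu)
      (Finset.mem_range.2 hu') hne
  unfold cycleExponent
  split_ifs with h
  · have h1 := hpair 0 (by omega) v hv (by omega)
    rw [hb0, hbs v (by omega)] at h1
    rcases hε with ⟨rfl, _, _⟩ | ⟨rfl, _, _⟩ <;> omega
  · have h1 := hpair v hv (v + 1) (by omega) (by omega)
    rw [hbs (v + 1) (by omega)] at h1
    by_cases hv0 : v = 0
    · subst hv0
      rw [hb0] at h1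
      rcases hε with ⟨rfl, _, _⟩ | ⟨rfl, _, _⟩ <;> omega
    · rw [hbs v hv0] at h1
      omega

/-- The exponents that occur for given parameters. -/
def cycleExponents (n : ℕ) (ε N T lo hi : ℤ) : Set (Fin n →₀ ℕ) :=
  {α | ∃ a, IsMultiplicity n ε N lo hi a ∧ ∀ v : Fin n, (α v : ℤ) = cycleExponent n ε N T a v}

theorem exists_cycleExponents {n : ℕ} (hn : 2 ≤ n) {ε N T lo hi : ℤ}
    (hε : IsAdmissible ε T lo hi) {a : ℕ → ℤ} (ha : IsMultiplicity n ε N lo hi a) :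
    ∃ α ∈ cycleExponents n ε N T lo hi, ∀ v : Fin n, (α v : ℤ) = cycleExponent n ε N T a v := by
  have h : ∀ v : Fin n, ((Finsupp.equivFunOnFinite.symm
      (fun v : Fin n => (cycleExponent n ε N T a v).toNat) v : ℕ) : ℤ) =
        cycleExponent n ε N T a v :=
    fun v => Int.toNat_of_nonneg (cycleExponent_nonneg hn hε ha v.isLt)
  exact ⟨_, ⟨a, ha, h⟩, h⟩

theorem hasLinearFreeResolution_cycleExponents {n : ℕ} (hn : 2 ≤ n) {ε N T lo hi : ℤ}
    (hε : IsAdmissible ε T lo hi) :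
    HasLinearFreeResolution (monomialSpan K (cycleExponents n ε N T lo hi)) := by
  refine hasLinearFreeResolution_monomialSpan (d := ((n - 2) * N + T).toNat) _ ?_ ?_
  · rintro α ⟨a, ha, hα⟩
    rw [← sum_cycleExponent (by omega) ha, Finset.sum_range, ← Finset.sum_congr rfl
      fun v _ => hα v, ← Nat.cast_sum, Int.toNat_natCast, Finsupp.degree_eq_sum]
  · rintro α ⟨a, ha, hα⟩ β ⟨b, hb, hβ⟩ v heq hlt
    obtain ⟨c, hc, h1, h2, h3⟩ := exists_exchange (T := T)
      (hε.elim (fun h => Or.inr h.1) fun h => Or.inl h.1) ha hb v.isLt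
      (fun w hw => by
        rw [← hα ⟨w, hw.trans v.isLt⟩, ← hβ ⟨w, hw.trans v.isLt⟩, heq _ hw])
      (by rw [← hα v, ← hβ v]; exact_mod_cast hlt)
    obtain ⟨γ, hγ, hγc⟩ := exists_cycleExponents hn hε hc
    refine ⟨γ, hγ, ?_, ?_, ?_⟩
    · intro w hw
      have h := h2 w hw
      rw [← hγc, ← hα] at h
      exact_mod_cast h
    · rw [← hγc, ← hα] at h3
      omega
    · intro w
      rw [Finsupp.add_apply, Finsupp.single_apply]
      split_ifs with hvw
      · subst hvw
        rw [← hγc, ← hα] at h3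
        omega
      · have h := h1 w w.isLt fun h => hvw (Fin.ext h.symm)
        rw [← hγc, ← hα] at h
        omega

theorem cycleExponents_zero {n : ℕ} (hn : 2 ≤ n) : cycleExponents n 1 0 0 0 0 = {0} := by
  ext α
  rw [Set.mem_singleton_iff]
  constructor
  · rintro ⟨a, ha, hα⟩
    have hd := sum_cycleExponent (T := 0) (by omega) ha
    rw [Finset.sum_range, ← Finset.sum_congr rfl fun v _ => hα v, ← Nat.cast_sum,
      ← Finsupp.degree_eq_sum] at hd
    rw [← Finsupp.degree_eq_zero_iff]
    rw [mul_zero, add_zero] at hd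
    exact_mod_cast hd
  · rintro rfl
    refine ⟨fun _ => 0, ⟨le_rfl, le_rfl, fun _ _ _ => le_rfl, by simp⟩, fun v => ?_⟩
    simp [cycleExponent]

/-- With `a 0 = 0` forced, `ε` plays no role; this starts the family `C` from the powers of `J_n`.
-/
theorem cycleExponents_eq_of_zero {n : ℕ} (N : ℤ) :
    cycleExponents n 1 N 0 0 0 = cycleExponents n 0 N 0 0 0 := by
  ext α
  refine exists_congr fun a => ?_
  constructor
  · rintro ⟨h, hα⟩
    have h0 : a 0 = 0 := le_antisymm h.le_hi h.lo_le
    refine ⟨⟨h.lo_le, h.le_hi, h.nonneg, by simpa [h0] using h.sum_eq⟩, fun v => ?_⟩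
    rw [hα v]
    simp [cycleExponent, h0]
  · rintro ⟨h, hα⟩
    have h0 : a 0 = 0 := le_antisymm h.le_hi h.lo_le
    refine ⟨⟨h.lo_le, h.le_hi, h.nonneg, by simpa [h0] using h.sum_eq⟩, fun v => ?_⟩
    rw [hα v]
    simp [cycleExponent, h0]

/-- The case `hi' = hi + 1` is multiplication by `I_n`, the case `hi = hi' = 0` multiplication by
`J_n`; the condition on `i` allows the special generator only in the former. -/
theorem cycleExponents_add_path {n : ℕ} (hn : 2 ≤ n) {N hi hi' : ℤ} (hN : 0 ≤ N) (h0 : 0 ≤ hi)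
    (h : hi' = hi + 1 ∨ hi = 0 ∧ hi' = 0) :
    cycleExponents n 1 N 0 0 hi + pathExponent n '' {i | i.val = 1 → hi < hi'} =
      cycleExponents n 1 (N + 1) 0 0 hi' := by
  ext γ
  rw [Set.mem_add]
  constructor
  · rintro ⟨α, ⟨a, ha, hα⟩, _, ⟨i, hi1, rfl⟩, rfl⟩
    obtain ⟨w, hw, hwi⟩ : ∃ w < n, i.val = (w + 1) % n := by
      rcases Nat.eq_zero_or_pos i.val with h | h
      · exact ⟨n - 1, by omega, by rw [h, Nat.sub_add_cancel (by omega), Nat.mod_self]⟩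
      · exact ⟨i.val - 1, by omega, by rw [Nat.sub_add_cancel h, Nat.mod_eq_of_lt i.isLt]⟩
    have hw0 : w = 0 → hi < hi' := by
      rintro rfl
      exact hi1 (by rw [hwi, Nat.mod_eq_of_lt (by omega)])
    refine ⟨fun u => a u + if u = w then 1 else 0, ⟨?_, ?_, ?_, ?_⟩, ?_⟩
    · have := ha.lo_le
      split_ifs <;> omega
    · have := ha.le_hi
      split_ifs <;> omega
    · intro v hv hvn
      have := ha.nonneg v hv hvn
      split_ifs <;> omega
    · have := ha.sum_eq
      rw [Finset.sum_add_distrib, Finset.sum_ite_eq', if_pos (Finset.mem_range.2 hw)]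
      linarith
    · intro v
      rw [Finsupp.add_apply, Nat.cast_add, hα, pathExponent_apply hn hw hwi, ← cycleExponent_add,
        add_zero]
  · rintro ⟨a, ha, hγ⟩
    have hlo := ha.lo_le
    have hhi := ha.le_hi
    -- Split off the special edge whenever it occurs, so that the remaining multiplicity at `0` is
    -- at most `hi`.
    obtain ⟨w, hw, hpos, hw0, hw1⟩ : ∃ w < n, 0 < a w ∧ (w = 0 → hi < hi') ∧
        (w ≠ 0 → a 0 ≤ hi) := by
      by_cases h1 : 0 < a 0
      · exact ⟨0, by omega, h1, fun _ => by omega, fun h => absurd rfl h⟩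
      · have hs := ha.sum_eq
        obtain ⟨w, hw, hpos⟩ : ∃ w ∈ Finset.range n, 0 < a w := by
          by_contra! hcon
          have := Finset.sum_nonpos hcon
          linarith
        refine ⟨w, Finset.mem_range.1 hw, hpos, ?_, fun _ => by omega⟩
        rintro rfl
        exact absurd hpos h1
    have hc : IsMultiplicity n 1 N 0 hi (fun u => a u - if u = w then 1 else 0) := by
      refine ⟨?_, ?_, ?_, ?_⟩
      · split_ifs with h
        · subst h; omega
        · omega
      · split_ifs with h
        · omega
        · have := hw1 (Ne.symm h)
          omega
      · intro v hv hvn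
        have := ha.nonneg v hv hvn
        split_ifs with h
        · subst h; omega
        · omega
      · have := ha.sum_eq
        rw [Finset.sum_sub_distrib, Finset.sum_ite_eq', if_pos (Finset.mem_range.2 hw)]
        linarith
    obtain ⟨α, hα, hαc⟩ := exists_cycleExponents (T := 0) hn (Or.inl ⟨rfl, rfl, le_rfl⟩) hc
    refine ⟨α, hα, _, ⟨⟨(w + 1) % n, Nat.mod_lt _ (by omega)⟩, ?_, rfl⟩, ?_⟩
    · intro h
      refine hw0 ?_
      simp only at h
      by_cases hwn : w + 1 = n
      · rw [hwn, Nat.mod_self] at h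
        omega
      · rw [Nat.mod_eq_of_lt (by omega)] at h
        omega
    · ext v
      have hv : ((α v + pathExponent n ⟨(w + 1) % n, Nat.mod_lt _ (by omega)⟩ v : ℕ) : ℤ) =
          γ v := by
        rw [Nat.cast_add, hαc, pathExponent_apply hn hw rfl, ← cycleExponent_add, hγ, add_zero]
        simp only [sub_add_cancel]
      exact_mod_cast hv

theorem IsMultiplicity.shift_zero {n : ℕ} (hn : 0 < n) {N lo hi lo' hi' r : ℤ} {a : ℕ → ℤ}
    (ha : IsMultiplicity n 0 N lo hi a) (h1 : lo' ≤ a 0 + r) (h2 : a 0 + r ≤ hi') :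
    IsMultiplicity n 0 N lo' hi' (fun u => a u + if u = 0 then r else 0) := by
  refine ⟨by simpa using h1, by simpa using h2, fun v hv hvn => ?_, ?_⟩
  · simpa [hv.ne'] using ha.nonneg v hv hvn
  · have := ha.sum_eq
    rw [Finset.sum_add_distrib, Finset.sum_ite_eq', if_pos (Finset.mem_range.2 hn), if_pos rfl]
    linarith

/-- With `q = 1`, the value `r = -1` is multiplication by the first variable and `r = 0` by the
last. -/
theorem cycleExponent_shift_zero {n : ℕ} (hn : 2 ≤ n) (N T q r : ℤ) (a : ℕ → ℤ) (v : ℕ) :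
    cycleExponent n 0 N (T + q) (fun u => a u + if u = 0 then r else 0) v =
      cycleExponent n 0 N T a v + if v + 1 = n then q + r else if v = 0 then - r else 0 := by
  simp only [cycleExponent]
  split_ifs <;> first | contradiction | omega

theorem cycleExponents_add_ends {n : ℕ} (hn : 2 ≤ n) {N T : ℤ} (hT : 0 ≤ T) :
    cycleExponents n 0 N T (-T) 0 +
        {Finsupp.single (⟨0, by omega⟩ : Fin n) 1, Finsupp.single (⟨n - 1, by omega⟩ : Fin n) 1} =
      cycleExponents n 0 N (T + 1) (-(T + 1)) 0 := by
  have hfirst : ∀ v : Fin n, ((Finsupp.single (⟨0, by omega⟩ : Fin n) 1 v : ℕ) : ℤ) =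
      if v.val + 1 = n then 1 + -1 else if v.val = 0 then - -1 else 0 := by
    intro v
    simp only [Finsupp.single_apply, Fin.ext_iff]
    split_ifs <;> omega
  have hlast : ∀ v : Fin n, ((Finsupp.single (⟨n - 1, by omega⟩ : Fin n) 1 v : ℕ) : ℤ) =
      if v.val + 1 = n then 1 + 0 else if v.val = 0 then - 0 else 0 := by
    intro v
    simp only [Finsupp.single_apply, Fin.ext_iff]
    split_ifs <;> omega
  ext γ
  rw [Set.mem_add]
  constructor
  · rintro ⟨α, ⟨a, ha, hα⟩, β, hβ, rfl⟩
    have hlo := ha.lo_le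
    have hhi := ha.le_hi
    rcases hβ with rfl | rfl
    · refine ⟨_, ha.shift_zero (r := -1) (by omega) (by omega) (by omega), fun v => ?_⟩
      rw [cycleExponent_shift_zero hn, Finsupp.add_apply, Nat.cast_add, hα, hfirst]
    · refine ⟨_, ha.shift_zero (r := 0) (by omega) (by omega) (by omega), fun v => ?_⟩
      rw [cycleExponent_shift_zero hn, Finsupp.add_apply, Nat.cast_add, hα, hlast]
  · rintro ⟨a, ha, hγ⟩
    have hlo := ha.lo_le
    have hhi := ha.le_hi
    -- Split off the last variable unless `a 0 = -(T + 1)`, when all end factors are the first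
    -- variable.
    obtain ⟨r, β, hβ, hβr, h1, h2⟩ : ∃ r : ℤ, ∃ β ∈ ({Finsupp.single (⟨0, by omega⟩ : Fin n) 1,
        Finsupp.single (⟨n - 1, by omega⟩ : Fin n) 1} : Set (Fin n →₀ ℕ)),
        (∀ v : Fin n, ((β v : ℕ) : ℤ) =
          if v.val + 1 = n then 1 + -r else if v.val = 0 then - -r else 0) ∧
        -T ≤ a 0 + r ∧ a 0 + r ≤ 0 := by
      by_cases h : -T ≤ a 0
      · exact ⟨0, _, Or.inr rfl, hlast, by omega, by omega⟩
      · exact ⟨1, _, Or.inl rfl, hfirst, by omega, by omega⟩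
    obtain ⟨α, hα, hαc⟩ := exists_cycleExponents (T := T) hn (Or.inr ⟨rfl, by ring, le_rfl⟩)
      (ha.shift_zero (by omega) h1 h2)
    refine ⟨α, hα, β, hβ, ?_⟩
    ext v
    have hv : ((α v + β v : ℕ) : ℤ) = γ v := by
      rw [Nat.cast_add, hαc, hβr, hγ, ← cycleExponent_shift_zero hn]
      congr 1
      ext u
      split_ifs <;> ring
    exact_mod_cast hv

theorem pathIdealI_eq_monomialSpan (n : ℕ) :
    pathIdealI K n = monomialSpan K (pathExponent n '' Set.univ) := by
  rw [pathIdealI, monomialSpan, Set.image_univ, ← Set.range_comp]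
  congr 2
  ext1 i
  exact pathMonomial_eq_monomial n i

theorem pathIdealJ_eq_monomialSpan (n : ℕ) :
    pathIdealJ K n = monomialSpan K (pathExponent n '' {i | i.val ≠ 1}) := by
  rw [pathIdealJ, monomialSpan, ← Set.image_comp]
  congr 2
  ext1 i
  exact pathMonomial_eq_monomial n i

theorem pathIdealJ_pow_eq {n : ℕ} (hn : 2 ≤ n) (s : ℕ) :
    pathIdealJ K n ^ s = monomialSpan K (cycleExponents n 1 s 0 0 0) := by
  induction s with
  | zero =>
    rw [Nat.cast_zero, cycleExponents_zero hn, pow_zero, monomialSpan, Set.image_singleton]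
    simp
  | succ s ih =>
    rw [pow_succ, ih, pathIdealJ_eq_monomialSpan, monomialSpan_mul, Nat.cast_succ,
      ← cycleExponents_add_path (hi := 0) hn (by positivity) le_rfl (Or.inr ⟨rfl, rfl⟩)]
    simp

theorem idealB_eq {n : ℕ} (hn : 2 ≤ n) (s t : ℕ) :
    idealB K n s t = monomialSpan K (cycleExponents n 1 (s + t) 0 0 t) := by
  unfold idealB
  induction t with
  | zero => simp [pathIdealJ_pow_eq hn]
  | succ t ih =>
    rw [pow_succ, ← mul_assoc, ih, pathIdealI_eq_monomialSpan, monomialSpan_mul, Nat.cast_succ,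
      ← add_assoc, ← cycleExponents_add_path (hi := t) hn (by positivity) (by positivity)
        (Or.inl rfl)]
    simp

theorem idealC_eq {n : ℕ} (hn : 2 ≤ n) (s t : ℕ) :
    idealC K n hn s t = monomialSpan K (cycleExponents n 0 s t (-t) 0) := by
  unfold idealC
  induction t with
  | zero => simp [pathIdealJ_pow_eq hn, cycleExponents_eq_of_zero]
  | succ t ih =>
    have hends : Ideal.span {X (⟨0, by omega⟩ : Fin n), X (⟨n - 1, by omega⟩ : Fin n)} =
        monomialSpan K {Finsupp.single (⟨0, by omega⟩ : Fin n) 1,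
          Finsupp.single (⟨n - 1, by omega⟩ : Fin n) 1} := by
      rw [monomialSpan, Set.image_pair]
      rfl
    rw [pow_succ, ← mul_assoc, ih, hends, monomialSpan_mul, Nat.cast_succ,
      ← cycleExponents_add_ends hn (by positivity)]

end CycleIdeals

end

theorem lemma4 (K : Type*) [Field K] (n : ℕ) (hn : 2 ≤ n) (s t : ℕ) :
    HasLinearFreeResolution (idealB K n s t) ∧ HasLinearFreeResolution (idealC K n hn s t) := by
  rw [idealB_eq hn, idealC_eq hn]
  exact ⟨hasLinearFreeResolution_cycleExponents hn (Or.inl ⟨rfl, rfl, le_rfl⟩),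
    hasLinearFreeResolution_cycleExponents hn (Or.inr ⟨rfl, by ring, le_rfl⟩)⟩
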